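/- Let $A$ be a finite set, $P$ a probability mass function on $A$ with $P(a)>0$ for all $a\in A$, and $\rho:A\times A\to[0,\infty)$ a function such that for each $a\in A$ there is a $b\in A$ with $\rho(a,b)=0$. For $n\ge1$ and $x,y\in A^n$ put $\rho_n(x,y)=\frac1n\sum_{i=1}^n\rho(x_i,y_i)$. A codebook is a nonempty set $C_n\subset A^n$; for it let $\rho_n(x,C_n)=\min_{y\in C_n}\rho_n(x,y)$ and $[C_n]_D=\{x\in A^n:\rho_n(x,y)\le D\text{ for some }y\in C_n\}$. Let $P^n$ be the product distribution on $A^n$, let $X_1^n=(X_1,\ldots,X_n)$ have distribution $P^n$, and let $\log$ be the natural logarithm. For $D\ge0$ let $$R_S(D)=\inf_Q\ \inf_{W\in\mathcal M(P,Q,D)}H(W\|P\times Q),\qquad H(\mu\|\nu)=\sum_s\mu(s)\log\frac{\mu(s)}{\nu(s)},$$ where $Q$ ranges over all probability mass functions on $A$ and $\mathcal M(P,Q,D)$ is the set of probability mass functions $W$ on $A\times A$ with first marginal $P$, second marginal $Q$ and $\sum_{a,b}W(a,b)\rho(a,b)\le D$ (an infimum over the empty set is $\infty$). **Corollary 2 (Data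 Compression).** For any $n\ge1$, if the average distortion achieved by a codebook $C_n\subset A^n$ is $D=E_{P^n}[\rho_n(X_1^n,C_n)]$, then $$\frac1n\log|C_n|\ge R_S(D).$$ Moreover, for any $D\ge0$ there is a sequence of codebooks $C_n\subset A^n$ such that $P^n([C_n]_D)\to1$, $$\lim_{n\to\infty}\frac1n\log|C_n|=R_S(D),$$ and, provided that $D\le\max_{b\in A}\sum_{a\in A}P(a)\rho(a,b)$, also $E_{P^n}[\rho_n(X_1^n,C_n)]\to D$. (For larger $D$ the last convergence is impossible, since no codebook has average distortion exceeding this maximum.) -/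

import Mathlib

open Filter Topology

noncomputable section

namespace RateDistortion

/-- The single-letter distortion `ρ_n(x, y) = (1/n) ∑ ρ(x_i, y_i)` on `A^n`. -/
def blockDist {A : Type*} (ρ : A → A → ℝ) {n : ℕ} (x y : Fin n → A) : ℝ :=
  (1 / (n : ℝ)) * ∑ i, ρ (x i) (y i)

/-- The distortion `ρ_n(x, C) = min_{y ∈ C} ρ_n(x, y)` from a point to a (nonempty) codebook. -/
def distToCode {A : Type*} (ρ : A → A → ℝ) {n : ℕ} (C : Finset (Fin n → A)) (hC : C.Nonempty)
    (x : Fin n → A) : ℝ :=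
  C.inf' hC (fun y => blockDist ρ x y)

/-- The `D`-blowup `[C]_D` of a codebook. -/
def blowup {A : Type*} (ρ : A → A → ℝ) {n : ℕ} (C : Finset (Fin n → A)) (D : ℝ) :
    Set (Fin n → A) :=
  {x | ∃ y ∈ C, blockDist ρ x y ≤ D}

/-- The mass function of the product distribution `P^n` on `A^n`. -/
def prodMass {A : Type*} (P : A → ℝ) {n : ℕ} (x : Fin n → A) : ℝ :=
  ∏ i, P (x i)

/-- The `P^n`-probability of a subset of `A^n`. -/
def prodProb {A : Type*} [Fintype A] (P : A → ℝ) {n : ℕ} (S : Set (Fin n → A)) : ℝ :=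
  ∑ x, S.indicator (prodMass P) x

/-- The average distortion `E_{P^n}[ρ_n(X, C)]` achieved by a codebook. -/
def avgDist {A : Type*} [Fintype A] (P : A → ℝ) (ρ : A → A → ℝ) {n : ℕ}
    (C : Finset (Fin n → A)) (hC : C.Nonempty) : ℝ :=
  ∑ x, prodMass P x * distToCode ρ C hC x

open Classical in
/-- Relative entropy `H(μ‖ν) = ∑ μ(s) log (μ(s)/ν(s))` (natural logarithm) of two mass functions
on a finite set, equal to `∞` when `μ` is not absolutely continuous with respect to `ν`. -/
def relEntropy {S : Type*} [Fintype S] (μ ν : S → ℝ) : EReal :=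
  if ∀ s, ν s = 0 → μ s = 0 then ((∑ s, μ s * Real.log (μ s / ν s) : ℝ) : EReal) else ⊤

/-- `𝓜(P, Q, D)`: probability mass functions on `A × A` with marginals `P` and `Q` and expected
distortion at most `D`. -/
def couplings {A : Type*} [Fintype A] (ρ : A → A → ℝ) (P Q : A → ℝ) (D : ℝ) :
    Set (A × A → ℝ) :=
  {W | W ∈ stdSimplex ℝ (A × A) ∧ (∀ a, ∑ b, W (a, b) = P a) ∧ (∀ b, ∑ a, W (a, b) = Q b) ∧
    ∑ p : A × A, W p * ρ p.1 p.2 ≤ D}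

/-- `I(P, Q, D) = inf_{W ∈ 𝓜(P, Q, D)} H(W‖P × Q)`, equal to `∞` when `𝓜(P, Q, D)` is empty. -/
def minInfo {A : Type*} [Fintype A] (ρ : A → A → ℝ) (P Q : A → ℝ) (D : ℝ) : EReal :=
  ⨅ W ∈ couplings ρ P Q D, relEntropy W (fun p => P p.1 * Q p.2)

/-- Shannon's rate-distortion function `R_S(D) = inf_Q I(P, Q, D)`, the infimum being over all
probability mass functions `Q` on `A`. -/
def rateDist {A : Type*} [Fintype A] (ρ : A → A → ℝ) (P : A → ℝ) (D : ℝ) : EReal :=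
  ⨅ Q ∈ stdSimplex ℝ A, minInfo ρ P Q D

end RateDistortion

end

/-!
The rate-distortion function is a minimum: the second marginal of a joint law `W` with first marginal
`P` determines `Q`, the mutual information `I(W) = H(W‖P × Q)` is a continuous function of `W`, and
the constraint set is compact (`exists_rateDist_eq`). Compactness also makes `R_S` right-continuous
(`exists_pos_forall_lt_mutualInfo`). The Gibbs-type bound `sum_mul_log_le_mutualInfo` gives
nonnegativity and convexity of `I`; since `I(W) = 0` only for product laws, `R_S` is positive, hence
strictly decreasing, up to `min_b ∑ P(a) ρ(a, b)` (`mutualInfo_lt_of_meanDist_lt`).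

Converse. Let `φ(x)` be a codeword nearest to `x`, and `W` the law of `(X_J, φ(X)_J)` for a uniform
random coordinate `J`. Its mean distortion is the average distortion of the code. With the backward
channel `V(a|b) = W(a, b) / Q(b)`, Jensen's inequality yields
`n I(W) ≤ log ∑_x ∏ V(x_i|φ(x)_i) ≤ log ∑_{y ∈ C} ∑_x ∏ V(x_i|y_i) ≤ log |C|`
(`mutualInfo_letterLaw_le`), with no chain rule for entropies.

Achievability. Random coding covers almost all of `P^n` at distortion `D` with `exp (n (I(W) + ε))`
codewords (`exists_code_uncovered_le`, `eventually_exists_code`); a Chernoff bound supplies the law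
of large numbers. For each `n` one then takes the best of all codebooks, so tolerances may tend to
zero. Covering gives average distortion at most `D` in the limit; the converse and
right-continuity then give asymptotic rate at least `R_S(D)`. That the average distortion is also at
least `D` in the limit follows from strict monotonicity when `D ≤ min_b ∑ P(a) ρ(a, b)`. For larger
`D`, where `R_S(D) = 0`, a single codeword mixing two letters has the right average distortion
(`eventually_exists_codeword`).
-/

namespace RateDistortion

/-! ### Sums against product masses -/

section ProductMass

variable {S : Type*} [Fintype S] {P : S → ℝ} {n : ℕ}

lemma prodMass_nonneg (hP : P ∈ stdSimplex ℝ S) (x : Fin n → S) : 0 ≤ prodMass P x :=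
  Finset.prod_nonneg fun i _ => hP.1 (x i)

lemma sum_prodMass_mul_prod (P : S → ℝ) (g : Fin n → S → ℝ) :
    ∑ x : Fin n → S, prodMass P x * ∏ i, g i (x i) = ∏ i, ∑ s, P s * g i s := by
  classical
  rw [Finset.prod_univ_sum, Fintype.piFinset_univ]
  simp only [prodMass, Finset.prod_mul_distrib]

lemma sum_prodMass (hP : P ∈ stdSimplex ℝ S) : ∑ x : Fin n → S, prodMass P x = 1 := by
  have h := sum_prodMass_mul_prod P (fun (_ : Fin n) (_ : S) => (1 : ℝ))
  simpa [hP.2] using h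

lemma prodMass_mem_stdSimplex (hP : P ∈ stdSimplex ℝ S) :
    (prodMass P : (Fin n → S) → ℝ) ∈ stdSimplex ℝ (Fin n → S) :=
  ⟨prodMass_nonneg hP, sum_prodMass hP⟩

/-- The coordinates of a point distributed according to `P^n` have distribution `P`. -/
lemma sum_prodMass_mul_coord (hP : P ∈ stdSimplex ℝ S) (j : Fin n) (g : S → ℝ) :
    ∑ x : Fin n → S, prodMass P x * g (x j) = ∑ s, P s * g s := by
  classical
  have h := sum_prodMass_mul_prod P (fun (i : Fin n) (s : S) => if i = j then g s else 1)
  have h1 : ∀ x : Fin n → S, (∏ i, if i = j then g (x i) else 1) = g (x j) := fun x => by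
    simp
  have h2 : (∏ i : Fin n, ∑ s, P s * (if i = j then g s else 1)) = ∑ s, P s * g s := by
    rw [Finset.prod_eq_single j]
    · simp
    · intro i _ hij
      simp [hij, hP.2]
    · simp
  simp only [h1] at h
  rw [h, h2]

lemma prodProb_nonneg (hP : P ∈ stdSimplex ℝ S) (s : Set (Fin n → S)) : 0 ≤ prodProb P s :=
  Finset.sum_nonneg fun x _ => Set.indicator_nonneg (fun x _ => prodMass_nonneg hP x) x

lemma prodProb_add_compl (hP : P ∈ stdSimplex ℝ S) (s : Set (Fin n → S)) :
    prodProb P s + prodProb P sᶜ = 1 := by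
  rw [prodProb, prodProb, ← Finset.sum_add_distrib, ← sum_prodMass (n := n) hP]
  exact Finset.sum_congr rfl fun x _ => Set.indicator_self_add_compl_apply s _ x

lemma prodProb_le_one (hP : P ∈ stdSimplex ℝ S) (s : Set (Fin n → S)) : prodProb P s ≤ 1 := by
  linarith [prodProb_add_compl hP s, prodProb_nonneg hP sᶜ]

lemma prodProb_le_sum (hP : P ∈ stdSimplex ℝ S) {s : Set (Fin n → S)} {g : (Fin n → S) → ℝ}
    (h0 : ∀ x, 0 ≤ g x) (h1 : ∀ x ∈ s, prodMass P x ≠ 0 → 1 ≤ g x) :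
    prodProb P s ≤ ∑ x, prodMass P x * g x := by
  refine Finset.sum_le_sum fun x _ => ?_
  by_cases hx : x ∈ s
  · rw [Set.indicator_of_mem hx]
    by_cases hm : prodMass P x = 0
    · simp [hm]
    · exact le_mul_of_one_le_right (prodMass_nonneg hP x) (h1 x hx hm)
  · rw [Set.indicator_of_notMem hx]
    exact mul_nonneg (prodMass_nonneg hP x) (h0 x)

lemma prodProb_mono_of_support (hP : P ∈ stdSimplex ℝ S) {s t : Set (Fin n → S)}
    (h : ∀ x ∈ s, prodMass P x ≠ 0 → x ∈ t) : prodProb P s ≤ prodProb P t := by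
  classical
  refine (prodProb_le_sum hP (g := t.indicator 1) (fun x => Set.indicator_nonneg (by simp) x)
    (fun x hx hm => by simp [h x hx hm])).trans_eq ?_
  refine Finset.sum_congr rfl fun x _ => ?_
  by_cases hx : x ∈ t <;> simp [hx]

lemma prodProb_union_le (hP : P ∈ stdSimplex ℝ S) (s t : Set (Fin n → S)) :
    prodProb P (s ∪ t) ≤ prodProb P s + prodProb P t := by
  classical
  rw [prodProb, prodProb, prodProb, ← Finset.sum_add_distrib]
  refine Finset.sum_le_sum fun x _ => ?_
  have := prodMass_nonneg hP x
  by_cases hs : x ∈ s <;> by_cases ht : x ∈ t <;> simp [hs, ht, this]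

/-- Chernoff's bound for independent bounded summands of nonpositive mean, with a free
parameter `t`. -/
lemma prodProb_sum_gt_le_exp (hP : P ∈ stdSimplex ℝ S) (f : Fin n → S → ℝ) {B t δ : ℝ}
    (ht : 0 ≤ t) (htB : t * B ≤ 1) (hf : ∀ i s, |f i s| ≤ B)
    (hmean : ∀ i, ∑ s, P s * f i s ≤ 0) :
    prodProb P {x | n * δ < ∑ i, f i (x i)} ≤ Real.exp (n * (t ^ 2 * B ^ 2 - t * δ)) := by
  have h1 : prodProb P {x | n * δ < ∑ i, f i (x i)} ≤
      ∑ x : Fin n → S, prodMass P x * ∏ i, Real.exp (t * (f i (x i) - δ)) := by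
    refine prodProb_le_sum hP (fun x => Finset.prod_nonneg fun i _ => (Real.exp_pos _).le) ?_
    intro x hx _
    rw [← Real.exp_sum, Real.one_le_exp_iff, ← Finset.mul_sum, Finset.sum_sub_distrib]
    refine mul_nonneg ht ?_
    simp only [Set.mem_ofPred_eq] at hx
    simp only [Finset.sum_const, Finset.card_univ, Fintype.card_fin, nsmul_eq_mul]
    linarith
  refine h1.trans ?_
  rw [sum_prodMass_mul_prod P (fun i s => Real.exp (t * (f i s - δ))), Real.exp_nat_mul]
  refine (Finset.prod_le_prod (fun i _ => Finset.sum_nonneg fun s _ => mul_nonneg (hP.1 s)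
    (Real.exp_pos _).le) (g := fun _ => Real.exp (t ^ 2 * B ^ 2 - t * δ)) fun i _ => ?_).trans_eq
    (by simp)
  have h2 : ∀ s, Real.exp (t * f i s) ≤ 1 + t * f i s + t ^ 2 * B ^ 2 := fun s => by
    have hB : |t * f i s| ≤ t * B := by
      rw [abs_mul, abs_of_nonneg ht]
      exact mul_le_mul_of_nonneg_left (hf i s) ht
    have h3 := (abs_le.1 (Real.abs_exp_sub_one_sub_id_le (hB.trans htB))).2
    have h4 : (t * f i s) ^ 2 ≤ (t * B) ^ 2 := sq_le_sq' (abs_le.1 hB).1 (abs_le.1 hB).2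
    rw [mul_pow t B] at h4
    linarith
  calc ∑ s, P s * Real.exp (t * (f i s - δ))
      = (∑ s, P s * Real.exp (t * f i s)) * Real.exp (-(t * δ)) := by
        rw [Finset.sum_mul]
        refine Finset.sum_congr rfl fun s _ => ?_
        rw [mul_assoc, ← Real.exp_add]
        ring_nf
    _ ≤ Real.exp (t ^ 2 * B ^ 2) * Real.exp (-(t * δ)) := by
        refine mul_le_mul_of_nonneg_right ?_ (Real.exp_pos _).le
        calc ∑ s, P s * Real.exp (t * f i s)
            ≤ ∑ s, (P s + t * (P s * f i s) + t ^ 2 * B ^ 2 * P s) := by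
              refine Finset.sum_le_sum fun s _ => ?_
              have := mul_le_mul_of_nonneg_left (h2 s) (hP.1 s)
              linarith
          _ = 1 + t * (∑ s, P s * f i s) + t ^ 2 * B ^ 2 := by
              rw [Finset.sum_add_distrib, Finset.sum_add_distrib, ← Finset.mul_sum,
                ← Finset.mul_sum, hP.2, mul_one]
          _ ≤ t ^ 2 * B ^ 2 + 1 := by nlinarith [mul_nonneg ht (neg_nonneg.2 (hmean i))]
          _ ≤ _ := Real.add_one_le_exp _
    _ = Real.exp (t ^ 2 * B ^ 2 - t * δ) := by rw [← Real.exp_add, sub_eq_add_neg]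

/-- A weak law of large numbers, uniform over all families of summands bounded by `B`. -/
lemma eventually_prodProb_sum_gt_le (hP : P ∈ stdSimplex ℝ S) (B : ℝ) {δ ε : ℝ} (hδ : 0 < δ)
    (hε : 0 < ε) :
    ∀ᶠ n : ℕ in atTop, ∀ f : Fin n → S → ℝ, (∀ i s, |f i s| ≤ B) →
      (∀ i, ∑ s, P s * f i s ≤ 0) → prodProb P {x | n * δ < ∑ i, f i (x i)} ≤ ε := by
  set B' := max B 1
  have hB' : 0 < B' := lt_max_of_lt_right one_pos
  set t := min (1 / B') (δ / (2 * B' ^ 2))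
  have ht : 0 < t := lt_min (by positivity) (by positivity)
  have htB : t * B' ≤ 1 := by
    rw [← le_div_iff₀ hB']
    exact min_le_left _ _
  have hc : t ^ 2 * B' ^ 2 - t * δ ≤ -(t * δ / 2) := by
    have h : t * (2 * B' ^ 2) ≤ δ := by
      rw [← le_div_iff₀ (by positivity)]
      exact min_le_right _ _
    nlinarith [mul_le_mul_of_nonneg_left h ht.le]
  have hlim : Tendsto (fun n : ℕ => Real.exp (n * -(t * δ / 2))) atTop (𝓝 0) :=
    Real.tendsto_exp_atBot.comp
      (tendsto_natCast_atTop_atTop.atTop_mul_const_of_neg (by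
        have := mul_pos ht hδ
        linarith))
  filter_upwards [hlim.eventually_le_const hε] with n hn f hf hmean
  refine (prodProb_sum_gt_le_exp hP f ht.le htB (fun i s => (hf i s).trans (le_max_left _ _))
    hmean).trans (le_trans ?_ hn)
  exact Real.exp_le_exp.2 (mul_le_mul_of_nonneg_left hc n.cast_nonneg)

end ProductMass

/-! ### Covering by a random codebook -/

/-- Random coding in one shot. If `w` is a coupling of `p` with something, and on the relation `T`
its density with respect to `p × q` is at most `L`, then some `M` points drawn from `q` leave
uncovered (in the sense of `T`) at most the `w`-mass off `T` plus `exp (-M / L)`. -/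
lemma exists_code_uncovered_le {X Y : Type*} [Fintype X] [Fintype Y] {p : X → ℝ} {q : Y → ℝ}
    {w : X → Y → ℝ} (hp : p ∈ stdSimplex ℝ X) (hppos : ∀ x, 0 < p x) (hq : q ∈ stdSimplex ℝ Y)
    (hw : ∀ x y, 0 ≤ w x y) (hwp : ∀ x, ∑ y, w x y = p x) (T : X → Y → Prop)
    [∀ x y, Decidable (T x y)] {L : ℝ} (hL : 0 < L)
    (hT : ∀ x y, T x y → w x y ≤ L * (p x * q y)) (M : ℕ) :
    ∃ c : Fin M → Y, ∑ x, p x * (if ∀ j, ¬ T x (c j) then 1 else 0) ≤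
      ∑ x, ∑ y, (if T x y then 0 else w x y) + Real.exp (-(M / L)) := by
  set F : (Fin M → Y) → ℝ := fun c => ∑ x, p x * (if ∀ j, ¬ T x (c j) then 1 else 0)
  set R : ℝ := ∑ x, ∑ y, (if T x y then 0 else w x y) + Real.exp (-(M / L))
  -- The average of `F` over the random codebook is at most `R`.
  have hmean : ∑ c : Fin M → Y, prodMass q c * F c ≤ R := by
    have h1 : ∑ c : Fin M → Y, prodMass q c * F c =
        ∑ x, p x * (∑ y, q y * (if T x y then 0 else 1)) ^ M := by
      simp only [F, Finset.mul_sum]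
      rw [Finset.sum_comm]
      refine Finset.sum_congr rfl fun x _ => ?_
      have h2 := sum_prodMass_mul_prod q (fun (_ : Fin M) y => if T x y then (0 : ℝ) else 1)
      rw [Finset.prod_const, Finset.card_univ, Fintype.card_fin] at h2
      rw [← h2, Finset.mul_sum]
      refine Finset.sum_congr rfl fun c _ => ?_
      rw [mul_left_comm]
      congr 2
      by_cases h : ∀ j, ¬ T x (c j)
      · simp [h]
      · rw [if_neg h]
        push Not at h
        obtain ⟨j, hj⟩ := h
        exact (Finset.prod_eq_zero (Finset.mem_univ j) (by simp [hj])).symm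
    have h3 : ∀ x, p x * (∑ y, q y * (if T x y then 0 else 1)) ^ M ≤
        ∑ y, (if T x y then 0 else w x y) + p x * Real.exp (-(M / L)) := by
      intro x
      set a := ∑ y, q y * (if T x y then 1 else 0)
      set b := ∑ y, (if T x y then w x y else 0)
      have ha : ∑ y, q y * (if T x y then 0 else 1) = 1 - a := by
        rw [eq_sub_iff_add_eq, ← Finset.sum_add_distrib]
        refine (Finset.sum_congr rfl fun y _ => ?_).trans hq.2
        split_ifs <;> simp
      have hb : ∑ y, (if T x y then 0 else w x y) = p x - b := by
        rw [eq_sub_iff_add_eq, ← Finset.sum_add_distrib]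
        refine (Finset.sum_congr rfl fun y _ => ?_).trans (hwp x)
        split_ifs <;> simp
      have ha1 : 0 ≤ 1 - a := by
        rw [← ha]
        refine Finset.sum_nonneg fun y _ => mul_nonneg (hq.1 y) ?_
        split_ifs <;> simp
      have hb0 : 0 ≤ b := Finset.sum_nonneg fun y _ => by split_ifs <;> simp [hw]
      have hb1 : b ≤ p x := by
        have : 0 ≤ ∑ y, (if T x y then 0 else w x y) :=
          Finset.sum_nonneg fun y _ => by split_ifs <;> simp [hw]
        linarith
      have hba : b ≤ L * (p x * a) := by
        simp only [a, b, Finset.mul_sum]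
        refine Finset.sum_le_sum fun y _ => ?_
        split_ifs with h
        · simpa using hT x y h
        · simp
      set β := b / p x
      have hpx := hppos x
      have hβ0 : 0 ≤ β := div_nonneg hb0 hpx.le
      have hβ1 : β ≤ 1 := (div_le_one hpx).2 hb1
      have hβa : β / L ≤ a := by
        rw [div_le_iff₀ hL, div_le_iff₀ hpx]
        linarith
      have hpow : (1 - a) ^ M ≤ Real.exp (β * -(M / L)) := by
        calc (1 - a) ^ M ≤ Real.exp (-a) ^ M := by
              refine pow_le_pow_left₀ ha1 ?_ M
              linarith [Real.add_one_le_exp (-a)]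
          _ = Real.exp (-(M * a)) := by rw [← Real.exp_nat_mul, mul_neg]
          _ ≤ _ := by
              refine Real.exp_le_exp.2 ?_
              have := mul_le_mul_of_nonneg_left hβa (Nat.cast_nonneg (α := ℝ) M)
              have e : β * -((M : ℝ) / L) = -(M * (β / L)) := by ring
              linarith
      -- Convexity of `exp` on the segment from `0` to `-(M / L)`.
      have hconv : Real.exp (β * -(M / L)) ≤ (1 - β) + β * Real.exp (-(M / L)) := by
        have := convexOn_exp.2 (Set.mem_univ (0 : ℝ)) (Set.mem_univ (-((M : ℝ) / L)))
          (sub_nonneg.2 hβ1) hβ0 (by ring)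
        simpa using this
      rw [ha, hb]
      have hE := Real.exp_pos (-((M : ℝ) / L))
      have hβE : β * Real.exp (-(M / L)) ≤ Real.exp (-(M / L)) := mul_le_of_le_one_left hE.le hβ1
      have hpβ : p x * β = b := mul_div_cancel₀ b hpx.ne'
      calc p x * (1 - a) ^ M ≤ p x * ((1 - β) + Real.exp (-(M / L))) :=
            mul_le_mul_of_nonneg_left (by linarith) hpx.le
        _ = _ := by rw [mul_add, mul_sub, hpβ, mul_one]
    rw [h1]
    refine (Finset.sum_le_sum fun x _ => h3 x).trans_eq ?_
    rw [Finset.sum_add_distrib, ← Finset.sum_mul, hp.2, one_mul]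
  by_contra! hcon
  have hY := sum_prodMass (n := M) hq
  have : ∑ c : Fin M → Y, prodMass q c * R < ∑ c : Fin M → Y, prodMass q c * F c := by
    refine Finset.sum_lt_sum
      (fun c _ => mul_le_mul_of_nonneg_left (hcon c).le (prodMass_nonneg hq c)) ?_
    obtain ⟨c, -, hc⟩ : ∃ c ∈ (Finset.univ : Finset (Fin M → Y)), prodMass q c ≠ 0 :=
      Finset.exists_ne_zero_of_sum_ne_zero (by rw [hY]; exact one_ne_zero)
    exact ⟨c, Finset.mem_univ c,
      mul_lt_mul_of_pos_left (hcon c) ((prodMass_nonneg hq c).lt_of_ne' hc)⟩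
  rw [← Finset.sum_mul, hY, one_mul] at this
  linarith

/-! ### Mutual information and the single-letter optimization -/

section MutualInfo

variable {A : Type*} [Fintype A] {P : A → ℝ} {ρ : A → A → ℝ}

/-- The second marginal of a mass function on `A × A`. -/
noncomputable def sndMarginal (W : A × A → ℝ) (b : A) : ℝ := ∑ a, W (a, b)

/-- The mutual information `H(W‖P × Q)` of a joint law `W` with first marginal `P`, where `Q` is the
second marginal of `W`. Terms with `W p = 0` vanish, whatever the junk value of the logarithm. -/
noncomputable def mutualInfo (P : A → ℝ) (W : A × A → ℝ) : ℝ :=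
  ∑ p : A × A, W p * Real.log (W p / (P p.1 * sndMarginal W p.2))

/-- The expected distortion under a joint law. -/
noncomputable def meanDist (ρ : A → A → ℝ) (W : A × A → ℝ) : ℝ := ∑ p : A × A, W p * ρ p.1 p.2

/-- The probability mass functions on `A × A` with first marginal `P`. -/
def jointLaws (P : A → ℝ) : Set (A × A → ℝ) :=
  {W | W ∈ stdSimplex ℝ (A × A) ∧ ∀ a, ∑ b, W (a, b) = P a}

lemma le_sndMarginal {W : A × A → ℝ} (hW : ∀ p, 0 ≤ W p) (p : A × A) :
    W p ≤ sndMarginal W p.2 :=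
  Finset.single_le_sum (f := fun a => W (a, p.2)) (fun _ _ => hW _) (Finset.mem_univ p.1)

lemma sum_mul_snd (W : A × A → ℝ) (g : A → ℝ) :
    ∑ p : A × A, W p * g p.2 = ∑ b, sndMarginal W b * g b := by
  rw [Fintype.sum_prod_type_right]
  simp only [sndMarginal, Finset.sum_mul]

lemma sndMarginal_mem_stdSimplex {W : A × A → ℝ} (hW : W ∈ stdSimplex ℝ (A × A)) :
    sndMarginal W ∈ stdSimplex ℝ A := by
  refine ⟨fun b => Finset.sum_nonneg fun a _ => hW.1 _, ?_⟩
  have := sum_mul_snd W (fun _ => 1)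
  simpa [hW.2] using this.symm

lemma isCompact_jointLaws : IsCompact (jointLaws P) := by
  refine (isCompact_stdSimplex ℝ (A × A)).inter_right (t := {W | ∀ a, ∑ b, W (a, b) = P a}) ?_
  simp only [Set.ofPred_forall]
  exact isClosed_iInter fun a => isClosed_eq (by fun_prop) continuous_const

lemma continuous_meanDist (ρ : A → A → ℝ) : Continuous (meanDist ρ) := by
  unfold meanDist
  fun_prop

/-- Writing mutual information as a combination of entropies shows that it is continuous. -/
lemma continuousOn_mutualInfo (hPpos : ∀ a, 0 < P a) :
    ContinuousOn (mutualInfo P) (jointLaws P) := by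
  have hc : Continuous fun W : A × A → ℝ =>
      ∑ p, -Real.negMulLog (W p) - ∑ p : A × A, W p * Real.log (P p.1) +
        ∑ b, Real.negMulLog (∑ a, W (a, b)) := by
    fun_prop
  refine hc.continuousOn.congr fun W hW => ?_
  have h := sum_mul_snd W (fun b => Real.log (sndMarginal W b))
  have h' : ∑ b, Real.negMulLog (∑ a, W (a, b)) =
      -∑ p : A × A, W p * Real.log (sndMarginal W p.2) := by
    rw [h, ← Finset.sum_neg_distrib]
    simp [Real.negMulLog, sndMarginal]
  beta_reduce
  rw [h', ← sub_eq_add_neg, ← Finset.sum_sub_distrib, ← Finset.sum_sub_distrib, mutualInfo]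
  refine Finset.sum_congr rfl fun p _ => ?_
  rcases (hW.1.1 p).eq_or_lt with h0 | h0
  · simp [← h0]
  · have hQ : 0 < sndMarginal W p.2 := h0.trans_le (le_sndMarginal hW.1.1 p)
    rw [Real.log_div h0.ne' (mul_pos (hPpos _) hQ).ne', Real.log_mul (hPpos _).ne' hQ.ne',
      Real.negMulLog]
    ring

/-- The variational bound for mutual information: no backward channel `V` does better than the
one belonging to `W`. -/
lemma sum_mul_log_le_mutualInfo (hPpos : ∀ a, 0 < P a) {W V : A × A → ℝ} (hW : W ∈ jointLaws P)
    (hV : ∀ p, 0 ≤ V p) (hV1 : ∀ b, ∑ a, V (a, b) ≤ 1) (hpos : ∀ p, 0 < W p → 0 < V p) :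
    ∑ p : A × A, W p * Real.log (V p / P p.1) ≤ mutualInfo P W := by
  have hQ := sndMarginal_mem_stdSimplex hW.1
  have key : ∀ p : A × A, W p * Real.log (V p / P p.1) ≤
      W p * Real.log (W p / (P p.1 * sndMarginal W p.2)) +
        (sndMarginal W p.2 * V p - W p) := by
    intro p
    rcases (hW.1.1 p).eq_or_lt with h0 | h0
    · simp only [← h0, zero_mul, zero_add, sub_zero]
      exact mul_nonneg (hQ.1 _) (hV p)
    · have hq : 0 < sndMarginal W p.2 := h0.trans_le (le_sndMarginal hW.1.1 p)
      have hv := hpos p h0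
      have h1 := Real.log_le_sub_one_of_pos (div_pos (mul_pos hq hv) h0)
      rw [Real.log_div (mul_pos hq hv).ne' h0.ne', Real.log_mul hq.ne' hv.ne'] at h1
      rw [Real.log_div hv.ne' (hPpos _).ne', Real.log_div h0.ne' (mul_pos (hPpos _) hq).ne',
        Real.log_mul (hPpos _).ne' hq.ne']
      have h2 := mul_le_mul_of_nonneg_left h1 h0.le
      rw [mul_sub (W p) (_ / _), mul_div_cancel₀ _ h0.ne'] at h2
      linarith
  have hsum := Finset.sum_le_sum fun p (_ : p ∈ Finset.univ) => key p
  rw [Finset.sum_add_distrib, Finset.sum_sub_distrib, hW.1.2] at hsum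
  have hle : ∑ p : A × A, sndMarginal W p.2 * V p ≤ 1 := by
    rw [Fintype.sum_prod_type_right, ← hQ.2]
    refine Finset.sum_le_sum fun b _ => ?_
    dsimp only
    rw [← Finset.mul_sum]
    exact mul_le_of_le_one_right (hQ.1 b) (hV1 b)
  rw [mutualInfo]
  linarith

lemma mutualInfo_nonneg (hP : P ∈ stdSimplex ℝ A) (hPpos : ∀ a, 0 < P a) {W : A × A → ℝ}
    (hW : W ∈ jointLaws P) : 0 ≤ mutualInfo P W := by
  have := sum_mul_log_le_mutualInfo hPpos hW (V := fun p => P p.1) (fun p => (hPpos _).le)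
    (fun b => hP.2.le) (fun p _ => hPpos _)
  simpa [div_self (hPpos _).ne'] using this

/-- Mutual information is `∑ P Q φ(W / P Q)` with `φ(u) = u log u + 1 - u`, which vanishes only at
`u = 1`. -/
lemma eq_mul_of_mutualInfo_nonpos (hP : P ∈ stdSimplex ℝ A) (hPpos : ∀ a, 0 < P a)
    {W : A × A → ℝ} (hW : W ∈ jointLaws P) (h : mutualInfo P W ≤ 0) (p : A × A) :
    W p = P p.1 * sndMarginal W p.2 := by
  have hQ := sndMarginal_mem_stdSimplex hW.1
  set R : A × A → ℝ := fun p => P p.1 * sndMarginal W p.2 with hR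
  have hR0 : ∀ p, 0 ≤ R p := fun p => mul_nonneg (hPpos _).le (hQ.1 _)
  have hW0 : ∀ p, R p = 0 → W p = 0 := fun p hp => by
    have hq : sndMarginal W p.2 = 0 := (mul_eq_zero.1 hp).resolve_left (hPpos _).ne'
    exact le_antisymm (hq ▸ le_sndMarginal hW.1.1 p) (hW.1.1 p)
  have hsumR : ∑ p, R p = 1 := by
    rw [Fintype.sum_prod_type]
    simp only [hR, ← Finset.mul_sum, hQ.2, mul_one, hP.2]
  have hkl : ∑ p, R p * InformationTheory.klFun (W p / R p) = mutualInfo P W := by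
    have h1 : ∀ p, R p * InformationTheory.klFun (W p / R p) =
        W p * Real.log (W p / R p) + (R p - W p) := fun p => by
      by_cases hp : R p = 0
      · simp [hp, hW0 p hp]
      · rw [InformationTheory.klFun]
        field_simp
        ring
    rw [Finset.sum_congr rfl fun p _ => h1 p, Finset.sum_add_distrib, Finset.sum_sub_distrib,
      hsumR, hW.1.2, sub_self, add_zero]
    rfl
  have hnn : ∀ p ∈ Finset.univ, 0 ≤ R p * InformationTheory.klFun (W p / R p) := fun p _ =>
    mul_nonneg (hR0 p) (InformationTheory.klFun_nonneg (div_nonneg (hW.1.1 p) (hR0 p)))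
  have hz := (Finset.sum_eq_zero_iff_of_nonneg hnn).1
    (le_antisymm (hkl ▸ h) (Finset.sum_nonneg hnn)) p (Finset.mem_univ p)
  rcases mul_eq_zero.1 hz with hp | hp
  · rw [hW0 p hp]
    exact hp.symm
  · rw [InformationTheory.klFun_eq_zero_iff (div_nonneg (hW.1.1 p) (hR0 p))] at hp
    have hne : R p ≠ 0 := fun h0 => by simp [h0] at hp
    exact (div_eq_one_iff_eq hne).1 hp

lemma meanDist_add_smul (ρ : A → A → ℝ) (W₀ W₁ : A × A → ℝ) (s t : ℝ) :
    meanDist ρ (s • W₀ + t • W₁) = s * meanDist ρ W₀ + t * meanDist ρ W₁ := by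
  simp [meanDist, Finset.sum_add_distrib, Finset.mul_sum, add_mul, mul_assoc]

lemma convex_jointLaws : Convex ℝ (jointLaws P) := by
  intro W₀ h₀ W₁ h₁ s t hs ht hst
  refine ⟨convex_stdSimplex ℝ _ h₀.1 h₁.1 hs ht hst, fun a => ?_⟩
  simp [Finset.sum_add_distrib, ← Finset.mul_sum, h₀.2, h₁.2, ← add_mul, hst]

lemma mutualInfo_add_smul_le (hPpos : ∀ a, 0 < P a) {W₀ W₁ : A × A → ℝ} (h₀ : W₀ ∈ jointLaws P)
    (h₁ : W₁ ∈ jointLaws P) {s t : ℝ} (hs : 0 < s) (ht : 0 < t) (hst : s + t = 1) :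
    mutualInfo P (s • W₀ + t • W₁) ≤ s * mutualInfo P W₀ + t * mutualInfo P W₁ := by
  set W := s • W₀ + t • W₁ with hWdef
  have hW : W ∈ jointLaws P := convex_jointLaws h₀ h₁ hs.le ht.le hst
  -- Both terms are compared through the backward channel of the mixture.
  set V : A × A → ℝ := fun p => W p / sndMarginal W p.2
  have hQ := sndMarginal_mem_stdSimplex hW.1
  have hV : ∀ p, 0 ≤ V p := fun p => div_nonneg (hW.1.1 p) (hQ.1 _)
  have hV1 : ∀ b, ∑ a, V (a, b) ≤ 1 := fun b => by
    simp only [V, ← Finset.sum_div]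
    exact div_self_le_one _
  have hVpos : ∀ p, 0 < W p → 0 < V p := fun p hp =>
    div_pos hp (hp.trans_le (le_sndMarginal hW.1.1 p))
  have hWp : ∀ p, W p = s * W₀ p + t * W₁ p := fun p => by simp [hWdef]
  have e₀ := sum_mul_log_le_mutualInfo hPpos h₀ hV hV1 fun p hp => hVpos p (by
    rw [hWp]; have := h₁.1.1 p; positivity)
  have e₁ := sum_mul_log_le_mutualInfo hPpos h₁ hV hV1 fun p hp => hVpos p (by
    rw [hWp]; have := h₀.1.1 p; positivity)
  have e : mutualInfo P W = s * ∑ p : A × A, W₀ p * Real.log (V p / P p.1) +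
      t * ∑ p : A × A, W₁ p * Real.log (V p / P p.1) := by
    rw [mutualInfo, Finset.mul_sum, Finset.mul_sum, ← Finset.sum_add_distrib]
    refine Finset.sum_congr rfl fun p _ => ?_
    rw [mul_comm (P p.1), ← div_div]
    simp only [V]
    nth_rw 1 [hWp]
    ring
  rw [e]
  exact add_le_add (mul_le_mul_of_nonneg_left e₀ hs.le) (mul_le_mul_of_nonneg_left e₁ ht.le)

/-- Zero distortion is attainable by a deterministic channel. -/
lemma exists_mem_jointLaws_meanDist_eq_zero (hP : P ∈ stdSimplex ℝ A)
    (hρ0 : ∀ a, ∃ b, ρ a b = 0) : ∃ W ∈ jointLaws P, meanDist ρ W = 0 := by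
  classical
  choose f hf using hρ0
  have hm : ∀ a, ∑ b, (if b = f a then P a else 0) = P a := fun a => by simp
  refine ⟨fun p => if p.2 = f p.1 then P p.1 else 0, ⟨⟨fun p => ?_, ?_⟩, hm⟩, ?_⟩
  · dsimp only
    split_ifs
    exacts [hP.1 _, le_rfl]
  · rw [Fintype.sum_prod_type]
    simp only [hm, hP.2]
  · refine Finset.sum_eq_zero fun p _ => ?_
    by_cases h : p.2 = f p.1
    · simp [h, hf]
    · simp [h]

/-- The law of `(X, b)` with `X` distributed according to `P`. -/
lemma exists_mem_jointLaws_mutualInfo_eq_zero (hP : P ∈ stdSimplex ℝ A) (hPpos : ∀ a, 0 < P a)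
    (ρ : A → A → ℝ) (b : A) :
    ∃ W ∈ jointLaws P, mutualInfo P W = 0 ∧ meanDist ρ W = ∑ a, P a * ρ a b := by
  classical
  have hm : ∀ a, ∑ c, (if c = b then P a else 0) = P a := fun a => by simp
  refine ⟨fun p => if p.2 = b then P p.1 else 0, ⟨⟨fun p => ?_, ?_⟩, hm⟩, ?_, ?_⟩
  · dsimp only
    split_ifs
    exacts [hP.1 _, le_rfl]
  · rw [Fintype.sum_prod_type]
    simp only [hm, hP.2]
  · refine Finset.sum_eq_zero fun p _ => ?_
    by_cases h : p.2 = b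
    · simp [h, sndMarginal, hP.2, div_self (hPpos _).ne']
    · simp [h]
  · rw [meanDist, Fintype.sum_prod_type]
    simp

/-- The infimum defining `R_S(D)` is a minimum of the mutual information over joint laws. -/
lemma exists_rateDist_eq (hP : P ∈ stdSimplex ℝ A) (hPpos : ∀ a, 0 < P a)
    (hρ0 : ∀ a, ∃ b, ρ a b = 0) {D : ℝ} (hD : 0 ≤ D) :
    ∃ W ∈ jointLaws P, meanDist ρ W ≤ D ∧
      (∀ W' ∈ jointLaws P, meanDist ρ W' ≤ D → mutualInfo P W ≤ mutualInfo P W') ∧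
      rateDist ρ P D = (mutualInfo P W : EReal) := by
  have hcomp : IsCompact (jointLaws P ∩ {W | meanDist ρ W ≤ D}) :=
    isCompact_jointLaws.inter_right (isClosed_le (continuous_meanDist ρ) continuous_const)
  obtain ⟨W₁, h₁, h₁'⟩ := exists_mem_jointLaws_meanDist_eq_zero (ρ := ρ) hP hρ0
  obtain ⟨W, hW, hmin⟩ := hcomp.exists_isMinOn ⟨W₁, h₁, h₁'.trans_le hD⟩
    ((continuousOn_mutualInfo hPpos).mono Set.inter_subset_left)
  refine ⟨W, hW.1, hW.2, fun W' h h' => hmin ⟨h, h'⟩, ?_⟩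
  have hent : ∀ W' ∈ jointLaws P, relEntropy W' (fun p => P p.1 * sndMarginal W' p.2) =
      (mutualInfo P W' : EReal) := fun W' h => by
    rw [relEntropy, if_pos]
    · rfl
    · intro p hp
      have hq : sndMarginal W' p.2 = 0 := (mul_eq_zero.1 hp).resolve_left (hPpos _).ne'
      exact le_antisymm (hq ▸ le_sndMarginal h.1.1 p) (h.1.1 p)
  refine le_antisymm ?_ ?_
  · refine iInf₂_le_of_le (sndMarginal W) (sndMarginal_mem_stdSimplex hW.1.1) ?_
    refine iInf₂_le_of_le W ⟨hW.1.1, hW.1.2, fun b => rfl, hW.2⟩ ?_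
    rw [hent W hW.1]
  · refine le_iInf₂ fun Q _ => le_iInf₂ fun W' hW' => ?_
    have hJ : W' ∈ jointLaws P := ⟨hW'.1, hW'.2.1⟩
    have hQ : Q = sndMarginal W' := funext fun b => (hW'.2.2.1 b).symm
    rw [hQ, hent W' hJ, EReal.coe_le_coe_iff]
    exact hmin ⟨hJ, hW'.2.2.2⟩

/-- The rate-distortion function is right-continuous, by compactness. -/
lemma exists_pos_forall_lt_mutualInfo (hPpos : ∀ a, 0 < P a) {D r r' : ℝ} (hr : r' < r)
    (hmin : ∀ W ∈ jointLaws P, meanDist ρ W ≤ D → r ≤ mutualInfo P W) :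
    ∃ δ > 0, ∀ W ∈ jointLaws P, meanDist ρ W ≤ D + δ → r' < mutualInfo P W := by
  have hcomp : IsCompact (jointLaws P ∩ mutualInfo P ⁻¹' Set.Iic r') :=
    isCompact_jointLaws.of_isClosed_subset
      ((continuousOn_mutualInfo hPpos).preimage_isClosed_of_isClosed
        isCompact_jointLaws.isClosed isClosed_Iic) Set.inter_subset_left
  rcases (jointLaws P ∩ mutualInfo P ⁻¹' Set.Iic r').eq_empty_or_nonempty with hE | hE
  · refine ⟨1, one_pos, fun W hW _ => ?_⟩
    by_contra! h
    exact (Set.eq_empty_iff_forall_notMem.1 hE) W ⟨hW, h⟩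
  · obtain ⟨W₀, h₀, h₀min⟩ := hcomp.exists_isMinOn hE (continuous_meanDist ρ).continuousOn
    have hD : D < meanDist ρ W₀ := by
      by_contra! h
      exact absurd (hmin W₀ h₀.1 h) (not_le.2 (lt_of_le_of_lt h₀.2 hr))
    refine ⟨(meanDist ρ W₀ - D) / 2, by linarith, fun W hW hWD => ?_⟩
    by_contra! h
    have : meanDist ρ W₀ ≤ meanDist ρ W := h₀min ⟨hW, h⟩
    linarith

/-- The rate-distortion function strictly decreases up to the least distortion achieved by a
constant reproduction. -/
lemma mutualInfo_lt_of_meanDist_lt (hP : P ∈ stdSimplex ℝ A) (hPpos : ∀ a, 0 < P a) {d D r : ℝ}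
    (hdD : d < D) (hD : ∀ b, D ≤ ∑ a, P a * ρ a b)
    (hmin : ∀ W ∈ jointLaws P, meanDist ρ W ≤ D → r ≤ mutualInfo P W)
    {W₀ : A × A → ℝ} (h₀ : W₀ ∈ jointLaws P) (h₀d : meanDist ρ W₀ ≤ d) : r < mutualInfo P W₀ := by
  have hpos : 0 < mutualInfo P W₀ := by
    by_contra! h
    have hprod := eq_mul_of_mutualInfo_nonpos hP hPpos h₀ h
    have hQ := sndMarginal_mem_stdSimplex h₀.1
    have : D ≤ meanDist ρ W₀ := by
      calc D = ∑ b, sndMarginal W₀ b * D := by rw [← Finset.sum_mul, hQ.2, one_mul]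
        _ ≤ ∑ b, sndMarginal W₀ b * ∑ a, P a * ρ a b :=
            Finset.sum_le_sum fun b _ => mul_le_mul_of_nonneg_left (hD b) (hQ.1 b)
        _ = meanDist ρ W₀ := by
            rw [meanDist, Fintype.sum_prod_type_right]
            refine Finset.sum_congr rfl fun b _ => ?_
            rw [Finset.mul_sum]
            refine Finset.sum_congr rfl fun a _ => ?_
            rw [hprod (a, b)]
            ring
    linarith
  have hA : Nonempty A := by
    by_contra hA
    rw [not_nonempty_iff] at hA
    simpa using hP.2
  obtain ⟨b⟩ := hA
  obtain ⟨W₁, h₁, h₁I, h₁D⟩ := exists_mem_jointLaws_mutualInfo_eq_zero hP hPpos ρ b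
  set m := ∑ a, P a * ρ a b
  rcases (hD b).eq_or_lt with hm | hm
  · exact lt_of_le_of_lt ((hmin W₁ h₁ (h₁D.trans hm.symm |>.le)).trans_eq h₁I) hpos
  · have hmd : 0 < m - d := by linarith
    set t := (D - d) / (m - d) with ht_def
    have ht : 0 < t := div_pos (by linarith) hmd
    have ht1 : t < 1 := (div_lt_one hmd).2 (by linarith)
    have hs : 0 < 1 - t := by linarith
    have hmix := hmin _ (convex_jointLaws h₀ h₁ hs.le ht.le (by ring)) (by
      rw [meanDist_add_smul, h₁D]
      have h1 : t * (m - d) = D - d := div_mul_cancel₀ _ hmd.ne'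
      nlinarith [mul_le_mul_of_nonneg_left h₀d hs.le])
    have hconv := mutualInfo_add_smul_le hPpos h₀ h₁ hs ht (by ring)
    rw [h₁I] at hconv
    nlinarith [mul_pos ht hpos]

end MutualInfo

/-! ### The converse -/

section Converse

variable {A : Type*} {P : A → ℝ} {ρ : A → A → ℝ} {n : ℕ}

lemma distToCode_le {C : Finset (Fin n → A)} (hC : C.Nonempty) (x : Fin n → A) {y : Fin n → A}
    (hy : y ∈ C) : distToCode ρ C hC x ≤ blockDist ρ x y :=
  Finset.inf'_le _ hy

lemma exists_blockDist_eq_distToCode (ρ : A → A → ℝ) {C : Finset (Fin n → A)} (hC : C.Nonempty)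
    (x : Fin n → A) : ∃ y ∈ C, blockDist ρ x y = distToCode ρ C hC x := by
  obtain ⟨y, hy, h⟩ := Finset.exists_mem_eq_inf' hC (fun y => blockDist ρ x y)
  exact ⟨y, hy, h.symm⟩

lemma blockDist_nonneg (hρ : ∀ a b, 0 ≤ ρ a b) (x y : Fin n → A) : 0 ≤ blockDist ρ x y :=
  mul_nonneg (by positivity) (Finset.sum_nonneg fun i _ => hρ _ _)

lemma prodMass_pos (hPpos : ∀ a, 0 < P a) (x : Fin n → A) : 0 < prodMass P x :=
  Finset.prod_pos fun i _ => hPpos (x i)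

variable [Fintype A]

lemma avgDist_nonneg (hP : P ∈ stdSimplex ℝ A) (hρ : ∀ a b, 0 ≤ ρ a b) {C : Finset (Fin n → A)}
    (hC : C.Nonempty) : 0 ≤ avgDist P ρ C hC :=
  Finset.sum_nonneg fun x _ => mul_nonneg (prodMass_nonneg hP x)
    (Finset.le_inf' _ _ fun y _ => blockDist_nonneg hρ x y)

open Classical in
/-- The law of `(X_J, φ(X)_J)`, where `X` has distribution `P^n` and `J` is an independent
uniformly distributed coordinate. -/
noncomputable def letterLaw (P : A → ℝ) (φ : (Fin n → A) → Fin n → A) (p : A × A) : ℝ :=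
  (1 / (n : ℝ)) * ∑ i, ∑ x, prodMass P x * if (x i, φ x i) = p then 1 else 0

lemma sum_letterLaw_mul (P : A → ℝ) (φ : (Fin n → A) → Fin n → A) (g : A × A → ℝ) :
    ∑ p, letterLaw P φ p * g p =
      ∑ x, prodMass P x * ((1 / (n : ℝ)) * ∑ i, g (x i, φ x i)) := by
  classical
  calc ∑ p, letterLaw P φ p * g p
      = ∑ p, ∑ i, ∑ x, prodMass P x * (1 / (n : ℝ)) *
          ((if (x i, φ x i) = p then 1 else 0) * g p) := by
        refine Finset.sum_congr rfl fun p _ => ?_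
        rw [letterLaw, Finset.mul_sum, Finset.sum_mul]
        refine Finset.sum_congr rfl fun i _ => ?_
        rw [Finset.mul_sum, Finset.sum_mul]
        refine Finset.sum_congr rfl fun x _ => ?_
        ring
    _ = ∑ i, ∑ x, prodMass P x * (1 / (n : ℝ)) * g (x i, φ x i) := by
        rw [Finset.sum_comm]
        refine Finset.sum_congr rfl fun i _ => ?_
        rw [Finset.sum_comm]
        refine Finset.sum_congr rfl fun x _ => ?_
        rw [← Finset.mul_sum]
        simp
    _ = _ := by
        rw [Finset.sum_comm]
        refine Finset.sum_congr rfl fun x _ => ?_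
        rw [Finset.mul_sum, Finset.mul_sum]
        exact Finset.sum_congr rfl fun i _ => mul_assoc _ _ _

lemma letterLaw_mem_jointLaws (hP : P ∈ stdSimplex ℝ A) (hn : 1 ≤ n)
    (φ : (Fin n → A) → Fin n → A) : letterLaw P φ ∈ jointLaws P := by
  classical
  have hn0 : (n : ℝ) ≠ 0 := by positivity
  refine ⟨⟨fun p => ?_, ?_⟩, fun a => ?_⟩
  · refine mul_nonneg (by positivity) (Finset.sum_nonneg fun i _ => Finset.sum_nonneg fun x _ =>
      mul_nonneg (prodMass_nonneg hP x) ?_)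
    split_ifs <;> simp
  · have h := sum_letterLaw_mul P φ (fun _ => 1)
    simpa [hn0, sum_prodMass hP] using h
  · have h := sum_letterLaw_mul P φ (fun p => if p.1 = a then 1 else 0)
    rw [Fintype.sum_prod_type_right] at h
    simp only [mul_ite, mul_one, mul_zero, Finset.sum_ite_eq', Finset.mem_univ, if_true] at h
    rw [h]
    calc ∑ x, prodMass P x * ((1 / (n : ℝ)) * ∑ i : Fin n, if x i = a then 1 else 0)
        = (1 / (n : ℝ)) * ∑ i : Fin n, ∑ x, prodMass P x * if x i = a then 1 else 0 := by
          rw [Finset.sum_comm, Finset.mul_sum]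
          refine Finset.sum_congr rfl fun x _ => ?_
          rw [← Finset.mul_sum]
          ring
      _ = (1 / (n : ℝ)) * ∑ i : Fin n, P a := by
          congr 1
          refine Finset.sum_congr rfl fun i _ => ?_
          rw [sum_prodMass_mul_coord hP i (fun s => if s = a then 1 else 0)]
          simp
      _ = P a := by
          simp only [Finset.sum_const, Finset.card_univ, Fintype.card_fin, nsmul_eq_mul]
          field_simp

lemma letterLaw_pos (hP : P ∈ stdSimplex ℝ A) (hPpos : ∀ a, 0 < P a) (hn : 1 ≤ n)
    (φ : (Fin n → A) → Fin n → A) (x : Fin n → A) (i : Fin n) :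
    0 < letterLaw P φ (x i, φ x i) := by
  classical
  have hnn : ∀ i x, 0 ≤ prodMass P x * if (x i, φ x i) = (x i, φ x i) then (1 : ℝ) else 0 :=
    fun i x => by simpa using prodMass_nonneg hP x
  refine mul_pos (by positivity) (Finset.sum_pos' (fun j _ => Finset.sum_nonneg fun z _ => ?_)
    ⟨i, Finset.mem_univ i, Finset.sum_pos' (fun z _ => ?_) ⟨x, Finset.mem_univ x, ?_⟩⟩)
  · refine mul_nonneg (prodMass_nonneg hP z) ?_
    split_ifs <;> simp
  · refine mul_nonneg (prodMass_nonneg hP z) ?_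
    split_ifs <;> simp
  · simpa using prodMass_pos hPpos x

/-- The single-letter converse. With `V(a|b)` the backward channel of the letter law `W`, Jensen's
inequality gives `n I(W) = E log ∏ V(X_i|φ(X)_i) / P(X_i) ≤ log ∑_x ∏ V(x_i|φ(x)_i)`, and
each codeword contributes at most `1` to the last sum. -/
lemma mutualInfo_letterLaw_le (hP : P ∈ stdSimplex ℝ A) (hPpos : ∀ a, 0 < P a) (hn : 1 ≤ n)
    {φ : (Fin n → A) → Fin n → A} {C : Finset (Fin n → A)} (hφ : ∀ x, φ x ∈ C) :
    mutualInfo P (letterLaw P φ) ≤ (1 / (n : ℝ)) * Real.log C.card := by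
  classical
  set W := letterLaw P φ with hWdef
  have hW : W ∈ jointLaws P := letterLaw_mem_jointLaws hP hn φ
  have hQ := sndMarginal_mem_stdSimplex hW.1
  set V : A → A → ℝ := fun a b => W (a, b) / sndMarginal W b
  have hV0 : ∀ a b, 0 ≤ V a b := fun a b => div_nonneg (hW.1.1 _) (hQ.1 b)
  have hV1 : ∀ b, ∑ a, V a b ≤ 1 := fun b => by
    simp only [V, ← Finset.sum_div]
    exact div_self_le_one _
  have hVpos : ∀ x i, 0 < V (x i) (φ x i) := fun x i => by
    have h := letterLaw_pos hP hPpos hn φ x i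
    exact div_pos h (h.trans_le (le_sndMarginal hW.1.1 (x i, φ x i)))
  set u : (Fin n → A) → ℝ := fun x => ∏ i, V (x i) (φ x i) / P (x i)
  have hu : ∀ x, 0 < u x := fun x => Finset.prod_pos fun i _ => div_pos (hVpos x i) (hPpos _)
  have hI : mutualInfo P W = (1 / (n : ℝ)) * ∑ x, prodMass P x * Real.log (u x) := by
    have h := sum_letterLaw_mul P φ (fun p => Real.log (V p.1 p.2 / P p.1))
    have h' : mutualInfo P W = ∑ p, W p * Real.log (V p.1 p.2 / P p.1) := by
      refine Finset.sum_congr rfl fun p _ => ?_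
      rw [mul_comm (P p.1), ← div_div]
    have hlog : ∀ x, Real.log (u x) = ∑ i, Real.log (V (x i) (φ x i) / P (x i)) := fun x =>
      Real.log_prod fun i _ => (div_pos (hVpos x i) (hPpos (x i))).ne'
    rw [h', hWdef, h, Finset.mul_sum]
    refine Finset.sum_congr rfl fun x _ => ?_
    rw [hlog]
    ring
  have hjensen : ∑ x, prodMass P x * Real.log (u x) ≤ Real.log (∑ x, prodMass P x * u x) := by
    have := strictConcaveOn_log_Ioi.concaveOn.le_map_sum (t := Finset.univ)
      (w := prodMass P) (p := u) (fun x _ => prodMass_nonneg hP x) (sum_prodMass hP)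
      (fun x _ => hu x)
    simpa using this
  have hsum : ∑ x, prodMass P x * u x ≤ C.card := by
    have hVx : ∀ x, prodMass P x * u x = ∏ i, V (x i) (φ x i) := fun x => by
      simp only [u, prodMass]
      rw [← Finset.prod_mul_distrib]
      exact Finset.prod_congr rfl fun i _ => mul_div_cancel₀ _ (hPpos (x i)).ne'
    have hterm : ∀ x, ∏ i, V (x i) (φ x i) ≤ ∑ y ∈ C, ∏ i, V (x i) (y i) := fun x =>
      Finset.single_le_sum (f := fun y : Fin n → A => ∏ i, V (x i) (y i))
        (fun y _ => Finset.prod_nonneg fun i _ => hV0 (x i) (y i)) (hφ x)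
    calc ∑ x, prodMass P x * u x ≤ ∑ x : Fin n → A, ∑ y ∈ C, ∏ i, V (x i) (y i) :=
          Finset.sum_le_sum fun x _ => (hVx x).trans_le (hterm x)
      _ = ∑ y ∈ C, ∏ i, ∑ a, V a (y i) := by
          rw [Finset.sum_comm]
          refine Finset.sum_congr rfl fun y _ => ?_
          rw [Finset.prod_univ_sum, Fintype.piFinset_univ]
      _ ≤ ∑ y ∈ C, 1 := by
          refine Finset.sum_le_sum fun y _ => Finset.prod_le_one (fun i _ =>
            Finset.sum_nonneg fun a _ => hV0 a (y i)) fun i _ => hV1 (y i)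
      _ = C.card := by simp
  have hne : Nonempty (Fin n → A) := by
    by_contra h
    rw [not_nonempty_iff] at h
    simpa using sum_prodMass (n := n) hP
  have hpos : 0 < ∑ x, prodMass P x * u x :=
    Finset.sum_pos (fun x _ => mul_pos (prodMass_pos hPpos x) (hu x))
      Finset.univ_nonempty
  rw [hI]
  exact mul_le_mul_of_nonneg_left (hjensen.trans (Real.log_le_log hpos hsum)) (by positivity)

/-- A codebook yields a joint law with the same distortion and at most the same rate. -/
lemma exists_jointLaw_of_code (hP : P ∈ stdSimplex ℝ A) (hPpos : ∀ a, 0 < P a)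
    (ρ : A → A → ℝ) (hn : 1 ≤ n) (C : Finset (Fin n → A)) (hC : C.Nonempty) :
    ∃ W ∈ jointLaws P, meanDist ρ W = avgDist P ρ C hC ∧
      mutualInfo P W ≤ (1 / (n : ℝ)) * Real.log C.card := by
  choose φ hφC hφ using exists_blockDist_eq_distToCode ρ hC
  refine ⟨letterLaw P φ, letterLaw_mem_jointLaws hP hn φ, ?_,
    mutualInfo_letterLaw_le hP hPpos hn hφC⟩
  rw [meanDist, sum_letterLaw_mul P φ (fun p => ρ p.1 p.2)]
  exact Finset.sum_congr rfl fun x _ => by rw [← hφ x, blockDist]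

end Converse

/-! ### Achievability -/

section Achievability

variable {A : Type*} [Fintype A] {P : A → ℝ} {ρ : A → A → ℝ}

lemma one_sub_prodProb_le (hP : P ∈ stdSimplex ℝ A) {n : ℕ} {s t : Set (Fin n → A)}
    (h : sᶜ ⊆ t) : 1 - prodProb P s ≤ prodProb P t := by
  have h1 := prodProb_mono_of_support hP fun x (hx : x ∈ sᶜ) _ => h hx
  linarith [prodProb_add_compl hP s]

/-- The random coding bound: pairs drawn from `W^n` are typical, in that their information
density is near its mean `I(W)`, so about `exp (n I(W))` random codewords cover. -/
lemma eventually_exists_code_of_typical (hP : P ∈ stdSimplex ℝ A) (hPpos : ∀ a, 0 < P a)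
    {W : A × A → ℝ} (hW : W ∈ jointLaws P) {D : ℝ}
    (hD : ∀ ε > 0, ∀ᶠ n : ℕ in atTop, prodProb W
      {z : Fin n → A × A | D < blockDist ρ (fun i => (z i).1) (fun i => (z i).2)} ≤ ε)
    {ε : ℝ} (hε : 0 < ε) :
    ∀ᶠ n : ℕ in atTop, ∃ C : Finset (Fin n → A), C.Nonempty ∧
      1 - prodProb P (blowup ρ C D) ≤ ε ∧
        (1 / (n : ℝ)) * Real.log C.card - mutualInfo P W ≤ ε := by
  classical
  set I := mutualInfo P W
  have hI : 0 ≤ I := mutualInfo_nonneg hP hPpos hW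
  set Q := sndMarginal W
  have hQ : Q ∈ stdSimplex ℝ A := sndMarginal_mem_stdSimplex hW.1
  set ι : A × A → ℝ := fun p => Real.log (W p / (P p.1 * Q p.2))
  set δ := ε / 3 with hδdef
  have hδ : 0 < δ := by positivity
  have hbound : ∀ p, |ι p - I| ≤ ∑ p, |ι p - I| := fun p =>
    Finset.single_le_sum (f := fun p => |ι p - I|) (fun _ _ => abs_nonneg _) (Finset.mem_univ p)
  have hmean : ∑ p, W p * (ι p - I) ≤ 0 := by
    simp only [mul_sub, Finset.sum_sub_distrib, ← Finset.sum_mul, hW.1.2, one_mul]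
    exact (sub_self I).le
  have hexp : Tendsto (fun n : ℕ => Real.exp (-Real.exp (n * δ))) atTop (𝓝 0) :=
    Real.tendsto_exp_atBot.comp (tendsto_neg_atTop_atBot.comp (Real.tendsto_exp_atTop.comp
      (tendsto_natCast_atTop_atTop.atTop_mul_const hδ)))
  have hlog : Tendsto (fun n : ℕ => (1 / (n : ℝ)) * Real.log 2) atTop (𝓝 0) := by
    simpa using tendsto_one_div_atTop_nhds_zero_nat.mul_const (Real.log 2)
  filter_upwards [eventually_prodProb_sum_gt_le hW.1 (∑ p, |ι p - I|) hδ hδ, hD δ hδ,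
    hexp.eventually_le_const hδ, hlog.eventually_le_const hδ, eventually_ge_atTop 1]
    with n hn1 hn2 hn3 hn4 hn
  have hn0 : (0 : ℝ) < n := by positivity
  specialize hn1 (fun _ p => ι p - I) (fun _ p => hbound p) (fun _ => hmean)
  set L := Real.exp (n * (I + δ))
  set M := ⌈Real.exp (n * (I + 2 * δ))⌉₊
  let w : (Fin n → A) → (Fin n → A) → ℝ := fun x y => prodMass W fun i => (x i, y i)
  let T : (Fin n → A) → (Fin n → A) → Prop := fun x y =>
    w x y ≤ L * (prodMass P x * prodMass Q y) ∧ blockDist ρ x y ≤ D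
  have hwP : ∀ x, ∑ y, w x y = prodMass P x := fun x => by
    simp only [w, prodMass, ← hW.2]
    rw [Finset.prod_univ_sum, Fintype.piFinset_univ]
  obtain ⟨c, hc⟩ := exists_code_uncovered_le (prodMass_mem_stdSimplex (n := n) hP)
    (prodMass_pos hPpos) (prodMass_mem_stdSimplex (n := n) hQ)
    (w := w) (fun x y => prodMass_nonneg hW.1 _) hwP T (Real.exp_pos (n * (I + δ)))
    (fun x y h => h.1) M
  have hMge : Real.exp (n * (I + 2 * δ)) ≤ M := Nat.le_ceil _
  have hMpos : 0 < M := Nat.ceil_pos.2 (Real.exp_pos _)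
  have hcardM : (Finset.univ.image c).card ≤ M :=
    Finset.card_image_le.trans_eq (by simp)
  have hne : (Finset.univ.image c).Nonempty :=
    ⟨c ⟨0, hMpos⟩, Finset.mem_image_of_mem _ (Finset.mem_univ _)⟩
  refine ⟨Finset.univ.image c, hne, ?_, ?_⟩
  · have hcover : prodProb P (blowup ρ (Finset.univ.image c) D)ᶜ ≤
        ∑ x, prodMass P x * (if ∀ j, ¬ T x (c j) then 1 else 0) := by
      refine prodProb_le_sum hP (fun x => by split_ifs <;> simp) fun x hx _ => ?_
      rw [if_pos]
      intro j hT
      exact hx ⟨c j, Finset.mem_image_of_mem _ (Finset.mem_univ _), hT.2⟩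
    have hatyp : ∑ x, ∑ y, (if T x y then 0 else w x y) ≤ δ + δ := by
      have h1 : ∑ x, ∑ y, (if T x y then 0 else w x y) =
          prodProb W {z : Fin n → A × A | ¬ T (fun i => (z i).1) (fun i => (z i).2)} := by
        rw [← Fintype.sum_prod_type' (f := fun x y => if T x y then 0 else w x y), prodProb,
          ← (Equiv.arrowProdEquivProdArrow (Fin n) (fun _ => A) (fun _ => A)).sum_comp]
        refine Finset.sum_congr rfl fun z _ => ?_
        by_cases h : T (fun i => (z i).1) (fun i => (z i).2)
        · simp [Equiv.arrowProdEquivProdArrow, h]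
        · simp [Equiv.arrowProdEquivProdArrow, h, w]
      rw [h1]
      refine (prodProb_mono_of_support hW.1 ?_).trans
        ((prodProb_union_le hW.1 _ _).trans (add_le_add hn1 hn2))
      intro z hz hsupp
      by_contra hcon
      simp only [Set.mem_union, Set.mem_ofPred_eq, not_or, not_lt] at hcon
      refine hz ⟨?_, hcon.2⟩
      have hWz : ∀ i, 0 < W (z i) := fun i =>
        (hW.1.1 _).lt_of_ne' (Finset.prod_ne_zero_iff.1 hsupp i (Finset.mem_univ i))
      have hQz : ∀ i, 0 < Q (z i).2 := fun i =>
        (hWz i).trans_le (le_sndMarginal hW.1.1 (z i))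
      have hdens : w (fun i => (z i).1) (fun i => (z i).2) = Real.exp (∑ i, ι (z i)) *
          (prodMass P (fun i => (z i).1) * prodMass Q fun i => (z i).2) := by
        simp only [w, prodMass, Real.exp_sum, ← Finset.prod_mul_distrib]
        refine Finset.prod_congr rfl fun i _ => ?_
        have hpq := mul_pos (hPpos (z i).1) (hQz i)
        simp only [ι]
        rw [Real.exp_log (div_pos (hWz i) hpq), div_mul_cancel₀ _ hpq.ne']
      rw [hdens]
      refine mul_le_mul_of_nonneg_right (Real.exp_le_exp.2 ?_)
        (mul_nonneg (prodMass_nonneg hP _) (prodMass_nonneg hQ _))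
      have h2 := hcon.1
      simp only [Finset.sum_sub_distrib, Finset.sum_const, Finset.card_univ, Fintype.card_fin,
        nsmul_eq_mul] at h2
      linarith
    have hML : Real.exp (-(M / L)) ≤ δ := by
      refine le_trans (Real.exp_le_exp.2 (neg_le_neg ?_)) hn3
      rw [le_div_iff₀ (Real.exp_pos _), ← Real.exp_add]
      refine le_trans (Real.exp_le_exp.2 ?_) hMge
      linarith
    linarith [prodProb_add_compl hP (blowup ρ (Finset.univ.image c) D)]
  · have hMle : (M : ℝ) ≤ 2 * Real.exp (n * (I + 2 * δ)) := by
      have h1 : (M : ℝ) < Real.exp (n * (I + 2 * δ)) + 1 := Nat.ceil_lt_add_one (Real.exp_pos _).le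
      have h2 : 1 ≤ Real.exp (n * (I + 2 * δ)) := Real.one_le_exp (by positivity)
      linarith
    have hlogC : Real.log (Finset.univ.image c).card ≤ Real.log 2 + n * (I + 2 * δ) := by
      have hpos : (0 : ℝ) < (Finset.univ.image c).card := by exact_mod_cast hne.card_pos
      have hle : ((Finset.univ.image c).card : ℝ) ≤ M := by exact_mod_cast hcardM
      refine (Real.log_le_log hpos (hle.trans hMle)).trans_eq ?_
      rw [Real.log_mul two_ne_zero (Real.exp_pos _).ne', Real.log_exp]
    have h3 := mul_le_mul_of_nonneg_left hlogC (one_div_pos.2 hn0).le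
    have h4 : (1 / (n : ℝ)) * (n * (I + 2 * δ)) = I + 2 * δ := by field_simp
    rw [mul_add, h4] at h3
    linarith

lemma eventually_exists_code_of_meanDist_lt (hP : P ∈ stdSimplex ℝ A) (hPpos : ∀ a, 0 < P a)
    {W : A × A → ℝ} (hW : W ∈ jointLaws P) {D : ℝ} (hD : meanDist ρ W < D) {ε : ℝ}
    (hε : 0 < ε) :
    ∀ᶠ n : ℕ in atTop, ∃ C : Finset (Fin n → A), C.Nonempty ∧
      1 - prodProb P (blowup ρ C D) ≤ ε ∧
        (1 / (n : ℝ)) * Real.log C.card - mutualInfo P W ≤ ε := by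
  refine eventually_exists_code_of_typical hP hPpos hW (fun η hη => ?_) hε
  set g : A × A → ℝ := fun p => ρ p.1 p.2 - meanDist ρ W
  have hbound : ∀ p, |g p| ≤ ∑ p, |g p| := fun p =>
    Finset.single_le_sum (f := fun p => |g p|) (fun _ _ => abs_nonneg _) (Finset.mem_univ p)
  have hmean : ∑ p, W p * g p ≤ 0 := by
    simp only [g, mul_sub, Finset.sum_sub_distrib, ← Finset.sum_mul, hW.1.2, one_mul]
    exact (sub_self (meanDist ρ W)).le
  filter_upwards [eventually_prodProb_sum_gt_le hW.1 (∑ p, |g p|) (sub_pos.2 hD) hη,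
    eventually_ge_atTop 1] with n h hn
  refine le_trans (prodProb_mono_of_support hW.1 fun z hz _ => ?_)
    (h (fun _ p => g p) (fun _ p => hbound p) fun _ => hmean)
  have hn0 : (0 : ℝ) < n := by positivity
  simp only [Set.mem_ofPred_eq, blockDist] at hz
  rw [one_div, ← div_eq_inv_mul, lt_div_iff₀ hn0] at hz
  simp only [Set.mem_ofPred_eq, g, Finset.sum_sub_distrib, Finset.sum_const, Finset.card_univ,
    Fintype.card_fin, nsmul_eq_mul]
  linarith

/-- At distortion zero no slack is needed, since the pairs drawn from `W^n` have distortion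
exactly zero. -/
lemma eventually_exists_code_of_meanDist_eq_zero (hP : P ∈ stdSimplex ℝ A)
    (hPpos : ∀ a, 0 < P a) (hρ : ∀ a b, 0 ≤ ρ a b) {W : A × A → ℝ} (hW : W ∈ jointLaws P)
    (hD : meanDist ρ W = 0) {ε : ℝ} (hε : 0 < ε) :
    ∀ᶠ n : ℕ in atTop, ∃ C : Finset (Fin n → A), C.Nonempty ∧
      1 - prodProb P (blowup ρ C 0) ≤ ε ∧
        (1 / (n : ℝ)) * Real.log C.card - mutualInfo P W ≤ ε := by
  refine eventually_exists_code_of_typical hP hPpos hW (fun η hη => .of_forall fun n => ?_) hε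
  refine (prodProb_mono_of_support hW.1 (t := ∅) fun z hz hsupp => ?_).trans
    (by simpa [prodProb] using hη.le)
  refine (lt_irrefl (0 : ℝ) (lt_of_lt_of_eq (Set.mem_ofPred_eq ▸ hz) ?_)).elim
  rw [blockDist, Finset.sum_eq_zero, mul_zero]
  intro i _
  have h0 := (Finset.sum_eq_zero_iff_of_nonneg fun p _ => mul_nonneg (hW.1.1 p) (hρ p.1 p.2)).1 hD
    (z i) (Finset.mem_univ _)
  exact (mul_eq_zero.1 h0).resolve_left
    (Finset.prod_ne_zero_iff.1 hsupp i (Finset.mem_univ i))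

lemma eventually_exists_code (hP : P ∈ stdSimplex ℝ A) (hPpos : ∀ a, 0 < P a)
    (hρ : ∀ a b, 0 ≤ ρ a b) (hρ0 : ∀ a, ∃ b, ρ a b = 0) {W : A × A → ℝ} (hW : W ∈ jointLaws P)
    {D : ℝ} (hD0 : 0 ≤ D) (hD : meanDist ρ W ≤ D) {ε : ℝ} (hε : 0 < ε) :
    ∀ᶠ n : ℕ in atTop, ∃ C : Finset (Fin n → A), C.Nonempty ∧
      1 - prodProb P (blowup ρ C D) ≤ ε ∧
        (1 / (n : ℝ)) * Real.log C.card - mutualInfo P W ≤ ε := by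
  rcases hD0.eq_or_lt with rfl | hDpos
  · exact eventually_exists_code_of_meanDist_eq_zero hP hPpos hρ hW
      (le_antisymm hD (Finset.sum_nonneg fun p _ => mul_nonneg (hW.1.1 p) (hρ _ _))) hε
  -- A small admixture of a zero-distortion law makes the distortion constraint strict.
  obtain ⟨W₁, h₁, h₁D⟩ := exists_mem_jointLaws_meanDist_eq_zero (ρ := ρ) hP hρ0
  have hI := mutualInfo_nonneg hP hPpos hW
  have hI₁ := mutualInfo_nonneg hP hPpos h₁
  set t := min (1 / 2) (ε / 2 / (mutualInfo P W₁ + 1))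
  have ht : 0 < t := lt_min (by norm_num) (by positivity)
  have ht1 : t ≤ 1 / 2 := min_le_left _ _
  have htI : t * (mutualInfo P W₁ + 1) ≤ ε / 2 := by
    rw [← le_div_iff₀ (by positivity)]
    exact min_le_right _ _
  have hs : 0 < 1 - t := by linarith
  have hmix := mutualInfo_add_smul_le hPpos hW h₁ hs ht (by ring)
  have hdist : meanDist ρ ((1 - t) • W + t • W₁) < D := by
    rw [meanDist_add_smul, h₁D]
    nlinarith [mul_le_mul_of_nonneg_left hD hs.le, mul_pos ht hDpos]
  filter_upwards [eventually_exists_code_of_meanDist_lt hP hPpos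
    (convex_jointLaws hW h₁ hs.le ht.le (by ring)) hdist (half_pos hε)] with n hn
  obtain ⟨C, hC, h1, h2⟩ := hn
  exact ⟨C, hC, by linarith, by nlinarith [mul_nonneg ht.le hI]⟩

lemma avgDist_singleton (hP : P ∈ stdSimplex ℝ A) {n : ℕ} (y : Fin n → A) :
    avgDist P ρ {y} (Finset.singleton_nonempty y) =
      (1 / (n : ℝ)) * ∑ i, ∑ a, P a * ρ a (y i) := by
  calc avgDist P ρ {y} (Finset.singleton_nonempty y)
      = ∑ i, ∑ x, (1 / (n : ℝ)) * (prodMass P x * ρ (x i) (y i)) := by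
        rw [Finset.sum_comm]
        refine Finset.sum_congr rfl fun x _ => ?_
        rw [distToCode, Finset.inf'_singleton, blockDist, ← Finset.mul_sum, ← Finset.mul_sum]
        ring
    _ = _ := by
        rw [Finset.mul_sum]
        refine Finset.sum_congr rfl fun i _ => ?_
        rw [← Finset.mul_sum, sum_prodMass_mul_coord hP i (fun a => ρ a (y i))]

/-- When `D` exceeds the mean distortion of some constant reproduction, a single codeword, mixing
two letters in suitable proportion, is enough for average distortion close to `D`. -/
lemma eventually_exists_codeword (hP : P ∈ stdSimplex ℝ A) {D : ℝ} {b₀ b₁ : A}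
    (h₀ : ∑ a, P a * ρ a b₀ < D) (h₁ : D ≤ ∑ a, P a * ρ a b₁) {ε : ℝ} (hε : 0 < ε) :
    ∀ᶠ n : ℕ in atTop, ∃ y : Fin n → A, 1 - prodProb P (blowup ρ {y} D) ≤ ε ∧
      D - avgDist P ρ {y} (Finset.singleton_nonempty y) ≤ ε := by
  set m : A → ℝ := fun b => ∑ a, P a * ρ a b
  change m b₀ < D at h₀
  change D ≤ m b₁ at h₁
  set δ := min (ε / 2) (D - m b₀)
  have hδ : 0 < δ := lt_min (half_pos hε) (sub_pos.2 h₀)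
  have hδε : δ ≤ ε / 2 := min_le_left _ _
  have hδD : δ ≤ D - m b₀ := min_le_right _ _
  have hgap : 0 < m b₁ - m b₀ := by linarith
  set θ := (D - δ - m b₀) / (m b₁ - m b₀)
  have hθ0 : 0 ≤ θ := div_nonneg (by linarith) hgap.le
  have hθ1 : θ ≤ 1 := (div_le_one hgap).2 (by linarith)
  have hθ : θ * (m b₁ - m b₀) = D - δ - m b₀ := div_mul_cancel₀ _ hgap.ne'
  set g : A × A → ℝ := fun p => ρ p.1 p.2 - m p.2
  have hbound : ∀ p, |g p| ≤ ∑ p, |g p| := fun p =>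
    Finset.single_le_sum (f := fun p => |g p|) (fun _ _ => abs_nonneg _) (Finset.mem_univ p)
  have hlim : Tendsto (fun n : ℕ => (1 / (n : ℝ)) * (m b₁ - m b₀)) atTop (𝓝 0) := by
    simpa using tendsto_one_div_atTop_nhds_zero_nat.mul_const (m b₁ - m b₀)
  filter_upwards [eventually_prodProb_sum_gt_le hP (∑ p, |g p|) hδ hε,
    hlim.eventually_le_const (half_pos hε), eventually_ge_atTop 1] with n h hn2 hn
  have hn0 : (0 : ℝ) < n := by positivity
  set k := ⌊n * θ⌋₊
  have hkle : (k : ℝ) ≤ n * θ := Nat.floor_le (by positivity)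
  have hklt : n * θ < k + 1 := Nat.lt_floor_add_one _
  have hkn : k ≤ n := by
    have : (k : ℝ) ≤ n := hkle.trans (mul_le_of_le_one_right hn0.le hθ1)
    exact_mod_cast this
  set y : Fin n → A := fun i => if i.val < k then b₁ else b₀
  have hsum : ∑ i, m (y i) = n * m b₀ + k * (m b₁ - m b₀) := by
    have h1 : ∀ i, m (y i) = m b₀ + if i.val < k then m b₁ - m b₀ else 0 := fun i => by
      by_cases hi : i.val < k <;> simp [y, hi]
    simp only [h1, Finset.sum_add_distrib, Finset.sum_const, Finset.card_univ, Fintype.card_fin,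
      nsmul_eq_mul]
    rw [← Finset.sum_filter, Finset.sum_const, nsmul_eq_mul, Fin.card_filter_val_lt,
      min_eq_right hkn]
  have hup : ∑ i, m (y i) ≤ n * (D - δ) := by
    rw [hsum]
    nlinarith [mul_le_mul_of_nonneg_right hkle hgap.le]
  have hlow : n * (D - δ) - (m b₁ - m b₀) ≤ ∑ i, m (y i) := by
    rw [hsum]
    nlinarith [mul_le_mul_of_nonneg_right hklt.le hgap.le]
  refine ⟨y, ?_, ?_⟩
  · refine (one_sub_prodProb_le hP fun x hx => ?_).trans
      (h (fun i a => g (a, y i)) (fun i a => hbound _) fun i => ?_)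
    · have hx' : D < blockDist ρ x y := by
        by_contra! hcon
        exact hx ⟨y, Finset.mem_singleton_self y, hcon⟩
      rw [blockDist, one_div, ← div_eq_inv_mul, lt_div_iff₀ hn0] at hx'
      simp only [Set.mem_ofPred_eq, g, Finset.sum_sub_distrib]
      linarith
    · simp only [g, mul_sub, Finset.sum_sub_distrib, ← Finset.sum_mul, hP.2, one_mul]
      exact (sub_self (m (y i))).le
  · rw [avgDist_singleton hP]
    have h2 := mul_le_mul_of_nonneg_left hlow (one_div_pos.2 hn0).le
    have h3 : (1 / (n : ℝ)) * (n * (D - δ)) = D - δ := by field_simp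
    rw [mul_sub, h3] at h2
    change D - (1 / (n : ℝ)) * ∑ i, m (y i) ≤ ε
    linarith

/-- Outside the `D`-blowup of the codebook the distortion is at most the largest letter
distortion `B`. -/
lemma avgDist_le (hP : P ∈ stdSimplex ℝ A) {B : ℝ} (hB0 : 0 ≤ B) (hB : ∀ a b, ρ a b ≤ B) {n : ℕ}
    {D : ℝ} (hD : 0 ≤ D) (C : Finset (Fin n → A)) (hC : C.Nonempty) :
    avgDist P ρ C hC ≤ D + B * (1 - prodProb P (blowup ρ C D)) := by
  classical
  have hB' : ∀ x y : Fin n → A, blockDist ρ x y ≤ B := fun x y => by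
    calc blockDist ρ x y ≤ (1 / (n : ℝ)) * ∑ i : Fin n, B :=
          mul_le_mul_of_nonneg_left (Finset.sum_le_sum fun i _ => hB _ _) (by positivity)
      _ = (n : ℝ) / n * B := by
          simp only [Finset.sum_const, Finset.card_univ, Fintype.card_fin, nsmul_eq_mul]
          ring
      _ ≤ B := mul_le_of_le_one_left hB0 (div_self_le_one _)
  have hpt : ∀ x, prodMass P x * distToCode ρ C hC x ≤
      D * prodMass P x + B * (blowup ρ C D)ᶜ.indicator (prodMass P) x := by
    intro x
    have hx0 := prodMass_nonneg hP x
    by_cases hx : x ∈ blowup ρ C D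
    · obtain ⟨y, hy, hxy⟩ := id hx
      rw [Set.indicator_of_notMem (by simpa using hx), mul_zero, add_zero, mul_comm]
      exact mul_le_mul_of_nonneg_right ((distToCode_le hC x hy).trans hxy) hx0
    · obtain ⟨y, hy⟩ := id hC
      rw [Set.indicator_of_mem hx]
      nlinarith [mul_le_mul_of_nonneg_left ((distToCode_le hC x hy).trans (hB' x y)) hx0,
        mul_nonneg hD hx0]
  refine (Finset.sum_le_sum fun x _ => hpt x).trans_eq ?_
  rw [Finset.sum_add_distrib, ← Finset.mul_sum, ← Finset.mul_sum, sum_prodMass hP, mul_one,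
    ← prodProb_add_compl hP (blowup ρ C D), add_sub_cancel_left, prodProb]

/-- A sequence that is asymptotically as good as every tolerance allows is obtained by taking, for
each `n`, the best of the finitely many candidates. -/
lemma exists_forall_eventually_le {α : ℕ → Type*} [∀ n, Finite (α n)] [∀ n, Nonempty (α n)]
    (F : ∀ n, α n → ℝ) (h : ∀ ε > 0, ∀ᶠ n in atTop, ∃ c, F n c ≤ ε) :
    ∃ c : ∀ n, α n, ∀ ε > 0, ∀ᶠ n in atTop, F n (c n) ≤ ε := by
  choose c hc using fun n => Finite.exists_min (F n)
  refine ⟨c, fun ε hε => ?_⟩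
  filter_upwards [h ε hε] with n ⟨c', hc'⟩
  exact (hc n c').trans hc'

end Achievability

/-! ### Asymptotics of good codebooks -/

section Asymptotics

variable {A : Type*} [Fintype A] {P : A → ℝ} {ρ : A → A → ℝ}
  {C : (n : ℕ) → Finset (Fin n → A)} {hC : ∀ n, (C n).Nonempty} {D r : ℝ}

lemma eventually_avgDist_le (hP : P ∈ stdSimplex ℝ A) (hρ : ∀ a b, 0 ≤ ρ a b) (hD : 0 ≤ D)
    (hprob : Tendsto (fun n => prodProb P (blowup ρ (C n) D)) atTop (𝓝 1)) {ε : ℝ}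
    (hε : 0 < ε) : ∀ᶠ n in atTop, avgDist P ρ (C n) (hC n) ≤ D + ε := by
  set B := ∑ p : A × A, ρ p.1 p.2
  have hB0 : 0 ≤ B := Finset.sum_nonneg fun p _ => hρ _ _
  have hB : ∀ a b, ρ a b ≤ B := fun a b =>
    Finset.single_le_sum (f := fun p : A × A => ρ p.1 p.2) (fun p _ => hρ _ _)
      (Finset.mem_univ (a, b))
  have hlim : Tendsto (fun n => B * (1 - prodProb P (blowup ρ (C n) D))) atTop (𝓝 0) := by
    simpa using (hprob.const_sub 1).const_mul B
  filter_upwards [hlim.eventually_le_const hε] with n hn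
  linarith [avgDist_le hP hB0 hB hD (C n) (hC n)]

/-- By the converse and right-continuity, codebooks covering at distortion `D` have asymptotic
rate at least `R_S(D)`. -/
lemma tendsto_rate (hP : P ∈ stdSimplex ℝ A) (hPpos : ∀ a, 0 < P a) (hρ : ∀ a b, 0 ≤ ρ a b)
    (hC : ∀ n, (C n).Nonempty) (hD : 0 ≤ D)
    (hmin : ∀ W ∈ jointLaws P, meanDist ρ W ≤ D → r ≤ mutualInfo P W)
    (hprob : Tendsto (fun n => prodProb P (blowup ρ (C n) D)) atTop (𝓝 1))
    (hrate : ∀ ε > 0, ∀ᶠ n : ℕ in atTop, (1 / (n : ℝ)) * Real.log (C n).card - r ≤ ε) :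
    Tendsto (fun n : ℕ => (1 / (n : ℝ)) * Real.log (C n).card) atTop (𝓝 r) := by
  refine tendsto_order.2 ⟨fun r' hr' => ?_, fun r' hr' => ?_⟩
  · obtain ⟨δ, hδ, h⟩ := exists_pos_forall_lt_mutualInfo hPpos hr' hmin
    filter_upwards [eventually_avgDist_le (hC := hC) hP hρ hD hprob hδ, eventually_ge_atTop 1]
      with n hn hn1
    obtain ⟨W, hW, hWD, hWI⟩ := exists_jointLaw_of_code hP hPpos ρ hn1 (C n) (hC n)
    exact (h W hW (hWD.trans_le hn)).trans_le hWI
  · filter_upwards [hrate ((r' - r) / 2) (by linarith)] with n hn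
    linarith

/-- Up to the least distortion of a constant reproduction, strict monotonicity of `R_S` and the
converse force the average distortion of rate-optimal codebooks to reach `D`. -/
lemma eventually_le_avgDist (hP : P ∈ stdSimplex ℝ A) (hPpos : ∀ a, 0 < P a)
    (hρ : ∀ a b, 0 ≤ ρ a b) (hρ0 : ∀ a, ∃ b, ρ a b = 0)
    (hmin : ∀ W ∈ jointLaws P, meanDist ρ W ≤ D → r ≤ mutualInfo P W)
    (hDb : ∀ b, D ≤ ∑ a, P a * ρ a b)
    (hrate : ∀ ε > 0, ∀ᶠ n : ℕ in atTop, (1 / (n : ℝ)) * Real.log (C n).card - r ≤ ε)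
    {ε : ℝ} (hε : 0 < ε) : ∀ᶠ n in atTop, D - avgDist P ρ (C n) (hC n) ≤ ε := by
  rcases lt_or_ge (D - ε) 0 with hneg | hnn
  · refine .of_forall fun n => ?_
    linarith [avgDist_nonneg hP hρ (hC n)]
  · obtain ⟨W₀, h₀, h₀D, h₀min, -⟩ := exists_rateDist_eq hP hPpos hρ0 hnn
    have hlt := mutualInfo_lt_of_meanDist_lt hP hPpos (sub_lt_self D hε) hDb hmin h₀ h₀D
    filter_upwards [hrate ((mutualInfo P W₀ - r) / 2) (by linarith), eventually_ge_atTop 1]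
      with n hn hn1
    by_contra! hcon
    obtain ⟨W, hW, hWD, hWI⟩ := exists_jointLaw_of_code hP hPpos ρ hn1 (C n) (hC n)
    have := h₀min W hW (by linarith)
    linarith

end Asymptotics

end RateDistortion

theorem corollary2 {A : Type*} [Fintype A] (P : A → ℝ) (hP : P ∈ stdSimplex ℝ A)
    (hPpos : ∀ a, 0 < P a) (ρ : A → A → ℝ) (hρ : ∀ a b, 0 ≤ ρ a b)
    (hρ0 : ∀ a, ∃ b, ρ a b = 0) :
    (∀ (n : ℕ), 1 ≤ n → ∀ (C : Finset (Fin n → A)) (hC : C.Nonempty),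
      RateDistortion.rateDist ρ P (RateDistortion.avgDist P ρ C hC) ≤
        (((1 / (n : ℝ)) * Real.log (C.card : ℝ) : ℝ) : EReal)) ∧
    (∀ D : ℝ, 0 ≤ D →
      ∃ (C : (n : ℕ) → Finset (Fin n → A)) (hC : ∀ n, (C n).Nonempty),
        ((∃ b, D ≤ ∑ a, P a * ρ a b) →
          Tendsto (fun n => RateDistortion.avgDist P ρ (C n) (hC n)) atTop (𝓝 D)) ∧
        Tendsto (fun n => RateDistortion.prodProb P (RateDistortion.blowup ρ (C n) D))
          atTop (𝓝 1) ∧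
        Tendsto (fun n : ℕ => (((1 / (n : ℝ)) * Real.log ((C n).card : ℝ) : ℝ) : EReal))
          atTop (𝓝 (RateDistortion.rateDist ρ P D))) := by
  open RateDistortion in
  refine ⟨fun n hn C hC => ?_, fun D hD => ?_⟩
  · obtain ⟨W, hW, hWD, hWI⟩ := exists_jointLaw_of_code hP hPpos ρ hn C hC
    obtain ⟨W₀, -, -, hmin, hR⟩ := exists_rateDist_eq hP hPpos hρ0 (avgDist_nonneg hP hρ hC)
    rw [hR, EReal.coe_le_coe_iff]
    exact (hmin W hW hWD.le).trans hWI
  obtain ⟨W, hW, hWD, hmin, hR⟩ := exists_rateDist_eq hP hPpos hρ0 hD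
  set r := mutualInfo P W
  have hr : 0 ≤ r := mutualInfo_nonneg hP hPpos hW
  have hA : Nonempty A := by
    by_contra hA
    rw [not_nonempty_iff] at hA
    simpa using hP.2
  -- It suffices to find codebooks that cover, have rate at most `R_S(D)` in the limit, and whose
  -- average distortion is at least `D` in the limit.
  suffices h : ∃ C : ∀ n, {C : Finset (Fin n → A) // C.Nonempty},
      (∀ ε > 0, ∀ᶠ n in atTop, 1 - prodProb P (blowup ρ (C n).1 D) ≤ ε) ∧
      (∀ ε > 0, ∀ᶠ n : ℕ in atTop, (1 / (n : ℝ)) * Real.log (C n).1.card - r ≤ ε) ∧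
      ((∃ b, D ≤ ∑ a, P a * ρ a b) →
        ∀ ε > 0, ∀ᶠ n in atTop, D - avgDist P ρ (C n).1 (C n).2 ≤ ε) by
    obtain ⟨C, hprob, hrate, havg⟩ := h
    have hprob' : Tendsto (fun n => prodProb P (blowup ρ (C n).1 D)) atTop (𝓝 1) := by
      refine tendsto_order.2 ⟨fun a ha => ?_, fun a ha => .of_forall fun n =>
        (prodProb_le_one hP _).trans_lt ha⟩
      filter_upwards [hprob ((1 - a) / 2) (by linarith)] with n hn
      linarith
    refine ⟨fun n => (C n).1, fun n => (C n).2, fun hb => ?_, hprob', ?_⟩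
    · refine tendsto_order.2 ⟨fun a ha => ?_, fun a ha => ?_⟩
      · filter_upwards [havg hb ((D - a) / 2) (by linarith)] with n hn
        linarith
      · filter_upwards [eventually_avgDist_le (hC := fun n => (C n).2) hP hρ hD hprob'
          (half_pos (sub_pos.2 ha))] with n hn
        linarith
    · rw [hR]
      exact continuous_coe_real_ereal.continuousAt.tendsto.comp
        (tendsto_rate hP hPpos hρ (fun n => (C n).2) hD hmin hprob' hrate)
  have hne : ∀ n, Nonempty {C : Finset (Fin n → A) // C.Nonempty} := fun n =>
    ⟨⟨Finset.univ, Finset.univ_nonempty⟩⟩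
  by_cases hcase : (∃ b, D ≤ ∑ a, P a * ρ a b) ∧ ∃ b, ∑ a, P a * ρ a b < D
  · obtain ⟨⟨b₁, h₁⟩, b₀, h₀⟩ := hcase
    obtain ⟨C, hCF⟩ := exists_forall_eventually_le
      (α := fun n => {C : Finset (Fin n → A) // C.Nonempty})
      (fun n C => max (1 - prodProb P (blowup ρ C.1 D))
        (max ((1 / (n : ℝ)) * Real.log C.1.card - r) (D - avgDist P ρ C.1 C.2)))
      fun ε hε => by
        filter_upwards [eventually_exists_codeword hP h₀ h₁ hε] with n ⟨y, hy1, hy2⟩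
        refine ⟨⟨{y}, Finset.singleton_nonempty y⟩, max_le hy1 (max_le ?_ hy2)⟩
        simp only [Finset.card_singleton, Nat.cast_one, Real.log_one, mul_zero]
        linarith
    simp only [max_le_iff] at hCF
    exact ⟨C, fun ε hε => (hCF ε hε).mono fun n h => h.1,
      fun ε hε => (hCF ε hε).mono fun n h => h.2.1,
      fun _ ε hε => (hCF ε hε).mono fun n h => h.2.2⟩
  · obtain ⟨C, hCF⟩ := exists_forall_eventually_le
      (α := fun n => {C : Finset (Fin n → A) // C.Nonempty})
      (fun n C => max (1 - prodProb P (blowup ρ C.1 D))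
        ((1 / (n : ℝ)) * Real.log C.1.card - r))
      fun ε hε => by
        filter_upwards [eventually_exists_code hP hPpos hρ hρ0 hW hD hWD hε]
          with n ⟨C, hC, h1, h2⟩
        exact ⟨⟨C, hC⟩, max_le h1 h2⟩
    simp only [max_le_iff] at hCF
    have hrate := fun ε (hε : 0 < ε) => (hCF ε hε).mono fun n h => h.2
    refine ⟨C, fun ε hε => (hCF ε hε).mono fun n h => h.1, hrate, fun hb ε hε => ?_⟩
    refine eventually_le_avgDist hP hPpos hρ hρ0 hmin (fun b => ?_) hrate hε
    by_contra! hlt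
    exact hcase ⟨hb, b, hlt⟩
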